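/- **Notation.** Identify $x=(x_0,x_1,x_2)\in\mathbb R^3$ with the reduced quaternion $x_0+x_1e_1+x_2e_2$, so $\overline x=x_0-x_1e_1-x_2e_2$, and put $\partial=\partial_0-e_1\partial_1-e_2\partial_2$, $\overline\partial=\partial_0+e_1\partial_1+e_2\partial_2$ (acting from the left), where $\partial_i=\partial/\partial x_i$. In spherical coordinates $x_0=\rho\cos\theta$, $x_1=\rho\sin\theta\cos\varphi$, $x_2=\rho\sin\theta\sin\varphi$ let, for $n,m\ge0$, $$U^+_{n,m}=\rho^nP_n^m(\cos\theta)\cos(m\varphi),\qquad U^-_{n,m}=\rho^nP_n^m(\cos\theta)\sin(m\varphi),$$ where $P_n^m(t)=(-1)^m(1-t^2)^{m/2}\frac{d^m}{dt^m}P_n(t)$ and $P_n$ is the Legendre polynomial; in particular $U^\pm_{n,m}=0$ for $m>n$. Put $U^\pm_{n,-1}=\mp\frac1{n(n+1)}U^\pm_{n,1}$ for $n\ge1$ and $U^\pm_{0,-1}=0$. For $n\ge0$ let $X^\pm_{n,m}=\partial U^\pm_{n+1,m}$, and for $n\ge2$ let $$Y^\pm_{n,m}=\overline x\,X^\pm_{n-1,m}+X^\pm_{n-1,m}\,\overline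 x+2(n+m)|x|^2X^\pm_{n-2,m},$$ $$\underline Z^+_{n,0}=-\tfrac1{2(n+2)}\big((e_2\overline\partial+\overline\partial e_2)U^+_{n+1,1}-(e_1\overline\partial+\overline\partial e_1)U^-_{n+1,1}\big),$$ $$\underline Z^\pm_{n,m}=\overline x\,X^\pm_{n-1,m}+X^\pm_{n-1,m}\,\overline x-U^\pm_{n,m}+(n+m)|x|^2X^\pm_{n-2,m}\qquad(m\ge1).$$ **Proposition.** Let $n\ge2$. In each formula the upper signs, or the lower signs, are taken throughout. (0) For $0\le m\le n+1$ (upper sign) and $1\le m\le n+1$ (lower sign), $$\begin{aligned}X^\pm_{n,m}={}&(n+m+1)U^\pm_{n,m}+\tfrac12\big((n+m)(n+m+1)U^\pm_{n,m-1}-U^\pm_{n,m+1}\big)e_1\\&\mp\tfrac12\big((n+m)(n+m+1)U^\mp_{n,m-1}+U^\mp_{n,m+1}\big)e_2.\end{aligned}$$ (1) For $0\le m\le n-1$ (upper sign) and $1\le m\le n-1$ (lower sign), $$\begin{aligned}(2n-1)Y^\pm_{n,m}={}&2(n-2m^2)U^\pm_{n,m}+2(2n+1)(n+m)(n-1+m)|x|^2U^\pm_{n-2,m}\\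 &+\big((n+m)(n-m+1)(2m-1)U^\pm_{n,m-1}+(2n+1)(n+m)(n+m-1)(n+m-2)|x|^2U^\pm_{n-2,m-1}\\ &\qquad+(2m+1)U^\pm_{n,m+1}-(2n+1)(n+m)|x|^2U^\pm_{n-2,m+1}\big)e_1\\ &\mp\big((n+m)(n-m+1)(2m-1)U^\mp_{n,m-1}+(2n+1)(n+m)(n+m-1)(n+m-2)|x|^2U^\mp_{n-2,m-1}\\ &\qquad-(2m+1)U^\mp_{n,m+1}+(2n+1)(n+m)|x|^2U^\mp_{n-2,m+1}\big)e_2.\end{aligned}$$ (2) $\underline Z^+_{n,0}=U^-_{n,1}e_1-U^+_{n,1}e_2$, and for $1\le m\le n$ and both signs, $$\begin{aligned}(2n-1)\underline Z^\pm_{n,m}={}&-(2m-1)(2m+1)U^\pm_{n,m}+(2n+3)(n+m)(n+m-1)|x|^2U^\pm_{n-2,m}\\ &+\big((n+m)(n-m+1)(2m-1)U^\pm_{n,m-1}+\tfrac{(2n+3)(n+m)(n+m-1)(n+m-2)}2|x|^2U^\pm_{n-2,m-1}\\ &\qquad+(2m+1)U^\pm_{n,m+1}-\tfrac{(2n+3)(n+m)}2|x|^2U^\pm_{n-2,m+1}\big)e_1\\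 &\mp\big((n+m)(n-m+1)(2m-1)U^\mp_{n,m-1}+\tfrac{(2n+3)(n+m)(n+m-1)(n+m-2)}2|x|^2U^\mp_{n-2,m-1}\\ &\qquad-(2m+1)U^\mp_{n,m+1}+\tfrac{(2n+3)(n+m)}2|x|^2U^\mp_{n-2,m+1}\big)e_2.\end{aligned}$$ -/

import Mathlib

noncomputable section

namespace Inframonogenic

/-- Points `x = (x₀, x₁, x₂)` of Euclidean three-space. -/
abbrev E3 := EuclideanSpace ℝ (Fin 3)

/-- The upper or lower choice of sign in the notation `±`. -/
inductive Sgn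
  | plus
  | minus

/-- The opposite sign; `U^∓` is `U` with the sign `s.flip` when `U^±` has the sign `s`. -/
def Sgn.flip : Sgn → Sgn
  | .plus => .minus
  | .minus => .plus

/-- The real number `±1`. -/
def Sgn.val : Sgn → ℝ
  | .plus => 1
  | .minus => -1

/-! ### Reduced quaternions -/

/-- The quaternion unit `e₁`. -/
def e₁ : Quaternion ℝ := ⟨0, 1, 0, 0⟩

/-- The quaternion unit `e₂`. -/
def e₂ : Quaternion ℝ := ⟨0, 0, 1, 0⟩

/-- The reduced quaternion `a + b e₁ + c e₂`. -/
def reduced (a b c : ℝ) : Quaternion ℝ := ⟨a, b, c, 0⟩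

/-- The point `x` of three-space as the reduced quaternion `x₀ + x₁ e₁ + x₂ e₂`. -/
def toQuat (x : E3) : Quaternion ℝ := reduced (x 0) (x 1) (x 2)

/-- The partial derivative `∂ᵢ f` of a quaternion-valued function. -/
def partialD (i : Fin 3) (f : E3 → Quaternion ℝ) (x : E3) : Quaternion ℝ :=
  lineDeriv ℝ f x (EuclideanSpace.single i (1 : ℝ))

/-- The operator `∂ = ∂₀ - e₁ ∂₁ - e₂ ∂₂`, acting from the left. -/
def dee (f : E3 → Quaternion ℝ) (x : E3) : Quaternion ℝ :=
  partialD 0 f x - e₁ * partialD 1 f x - e₂ * partialD 2 f x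

/-- The Cauchy-Riemann operator `∂₀ + e₁ ∂₁ + e₂ ∂₂`, acting from the left. -/
def deeBar (f : E3 → Quaternion ℝ) (x : E3) : Quaternion ℝ :=
  partialD 0 f x + e₁ * partialD 1 f x + e₂ * partialD 2 f x

/-! ### Solid spherical harmonics -/

/-- The Legendre polynomial `P_n = (1 / (2ⁿ n!)) (d/dt)ⁿ (t² - 1)ⁿ`. -/
def legendreP (n : ℕ) : Polynomial ℝ :=
  Polynomial.C (1 / (2 ^ n * (n.factorial : ℝ))) *
    Polynomial.derivative^[n] ((Polynomial.X ^ 2 - 1) ^ n)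

/-- The associated Legendre function
`P_n^m(t) = (-1)ᵐ (1 - t²)^(m/2) (d/dt)ᵐ P_n(t)` for `-1 ≤ t ≤ 1`; it vanishes for `m > n`. -/
def assocLegendre (n m : ℕ) (t : ℝ) : ℝ :=
  (-1) ^ m * Real.sqrt (1 - t ^ 2) ^ m * (Polynomial.derivative^[m] (legendreP n)).eval t

/-- The azimuth `φ` in the spherical coordinates `x₀ = ρ cos θ`, `x₁ = ρ sin θ cos φ`,
`x₂ = ρ sin θ sin φ`. -/
def azimuth (x : E3) : ℝ := Complex.arg ⟨x 1, x 2⟩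

/-- `cos (m φ)` for the upper sign and `sin (m φ)` for the lower one. -/
def trig : Sgn → ℝ → ℝ
  | .plus => Real.cos
  | .minus => Real.sin

/-- The solid spherical harmonic `U^±_{n,m} = ρⁿ P_n^m(cos θ) cos (m φ)` (upper sign),
`ρⁿ P_n^m(cos θ) sin (m φ)` (lower sign), with `ρ = |x|` and `cos θ = x₀ / |x|`.
In particular `U^±_{n,m} = 0` for `m > n`. -/
def solidU (s : Sgn) (n m : ℕ) (x : E3) : ℝ :=
  ‖x‖ ^ n * assocLegendre n m (x 0 / ‖x‖) * trig s (m * azimuth x)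

/-- The term `U^±_{n,m-1}`, where `U^±_{n,-1} = ∓ (1 / (n (n + 1))) U^±_{n,1}`
(which is zero for `n = 0`, as `U^±_{0,1} = 0`). -/
def solidUPred (s : Sgn) (n : ℕ) : ℕ → E3 → ℝ
  | 0, x => -s.val * (1 / ((n : ℝ) * ((n : ℝ) + 1))) * solidU s n 1 x
  | m + 1, x => solidU s n m x

/-! ### The basic inframonogenic polynomials -/

/-- Type 0: the monogenic polynomial `X^±_{n,m} = ∂ U^±_{n+1,m}`. -/
def polyX (s : Sgn) (n m : ℕ) : E3 → Quaternion ℝ :=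
  dee fun x => ((solidU s (n + 1) m x : ℝ) : Quaternion ℝ)

/-- Type 1, for `n ≥ 2`:
`Y^±_{n,m} = x̄ X^±_{n-1,m} + X^±_{n-1,m} x̄ + 2 (n + m) |x|² X^±_{n-2,m}`. -/
def polyY (s : Sgn) (n m : ℕ) (x : E3) : Quaternion ℝ :=
  star (toQuat x) * polyX s (n - 1) m x + polyX s (n - 1) m x * star (toQuat x)
    + (2 * ((n : ℝ) + m) * ‖x‖ ^ 2) • polyX s (n - 2) m x

/-- Type 2, for `n ≥ 2` and `m = 0`: the contragenic polynomial
`Z⁺_{n,0} = -(1 / (2 (n + 2))) ((e₂ ∂̄ + ∂̄ e₂) U⁺_{n+1,1} - (e₁ ∂̄ + ∂̄ e₁) U⁻_{n+1,1})`. -/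
def polyZ₀ (n : ℕ) (x : E3) : Quaternion ℝ :=
  (-(1 / (2 * ((n : ℝ) + 2)))) •
    ((e₂ * deeBar (fun y => ((solidU .plus (n + 1) 1 y : ℝ) : Quaternion ℝ)) x
        + deeBar (fun y => e₂ * ((solidU .plus (n + 1) 1 y : ℝ) : Quaternion ℝ)) x)
      - (e₁ * deeBar (fun y => ((solidU .minus (n + 1) 1 y : ℝ) : Quaternion ℝ)) x
        + deeBar (fun y => e₁ * ((solidU .minus (n + 1) 1 y : ℝ) : Quaternion ℝ)) x))

/-- Type 2, for `n ≥ 2` and `m ≥ 1`: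
`Z^±_{n,m} = x̄ X^±_{n-1,m} + X^±_{n-1,m} x̄ - U^±_{n,m} + (n + m) |x|² X^±_{n-2,m}`. -/
def polyZ (s : Sgn) (n m : ℕ) (x : E3) : Quaternion ℝ :=
  star (toQuat x) * polyX s (n - 1) m x + polyX s (n - 1) m x * star (toQuat x)
    - ((solidU s n m x : ℝ) : Quaternion ℝ)
    + (((n : ℝ) + m) * ‖x‖ ^ 2) • polyX s (n - 2) m x

end Inframonogenic

end

open Inframonogenic

/-! Away from the origin, with z = x₁ + i x₂, each U^±_{n,m} is (-1)^m times a zonal factor ρ^(n-m)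
P_n^{(m)}(x₀/ρ) times the real or imaginary part of z^m (`solidU_eq`). Identities between solid
harmonics thus reduce to identities between derivatives of Legendre polynomials, and all of those
follow from P'_{n+1} = t P'_n + (n+1) P_n and P'_{n+2} = (2n+3) P_{n+1} + P'_n, both read off
Rodrigues' formula.

Two facts about harmonics carry the theorem. Partial derivatives of U_{n+1,m} are combinations of
harmonics of degree n and orders m-1, m, m+1 (`hasLineDerivAt_solidU_of_pos`), which gives X. A
coordinate times U_{n+1,m} splits into harmonics of degree n+2 and |x|² times harmonics of degree n
(the `coord_*` lemmas), which gives the vector parts of x̄X + Xx̄. Its scalar part contains x₁b +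
x₂c, where X = a + b e₁ + c e₂; Euler's relation for homogeneous functions (`coord_mul_gradient`)
expresses this by x₀a and U. Each component of Y and Z is then a linear combination of these
identities.

The convention for U_{n,-1} makes the same formulas hold at m = 0. The origin is treated separately,
by growth bounds. -/

/-! ### Legendre polynomials -/

/-- The value at `t` of the `m`-th derivative of the Legendre polynomial `P_n`. -/
noncomputable def legendreDeriv (n m : ℕ) (t : ℝ) : ℝ :=
  (Polynomial.derivative^[m] (legendreP n)).eval t

/-- The normalized power `(X² - 1)ⁿ / (2ⁿ n!)` of the Rodrigues formula. -/
noncomputable def rodrigues (n : ℕ) : Polynomial ℝ :=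
  Polynomial.C (1 / (2 ^ n * (n.factorial : ℝ))) * (Polynomial.X ^ 2 - 1) ^ n

lemma legendreP_eq_iterate_derivative (n : ℕ) :
    legendreP n = Polynomial.derivative^[n] (rodrigues n) := by
  rw [legendreP, rodrigues, Polynomial.iterate_derivative_C_mul]

lemma C_rodrigues_coeff (n : ℕ) :
    Polynomial.C (1 / (2 ^ n * (n.factorial : ℝ)))
      = Polynomial.C (1 / (2 ^ (n + 1) * ((n + 1).factorial : ℝ)))
        * (2 * ((n : Polynomial ℝ) + 1)) := by
  have h : (1 / (2 ^ (n + 1) * ((n + 1).factorial : ℝ))) * (2 * ((n : ℝ) + 1))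
      = 1 / (2 ^ n * (n.factorial : ℝ)) := by
    have := Nat.factorial_ne_zero n
    have : (n : ℝ) + 1 ≠ 0 := by positivity
    rw [Nat.factorial_succ]
    push_cast
    field_simp
    ring
  rw [← h]
  simp only [map_mul, map_add, map_one, map_natCast, map_ofNat]

lemma derivative_rodrigues_succ (n : ℕ) :
    Polynomial.derivative (rodrigues (n + 1)) = rodrigues n * Polynomial.X := by
  rw [rodrigues, rodrigues, C_rodrigues_coeff n, Polynomial.derivative_C_mul, Polynomial.derivative_pow]
  simp only [Polynomial.derivative_sub, Polynomial.derivative_X_pow, Polynomial.derivative_one,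
    Nat.add_sub_cancel, map_natCast]
  push_cast
  ring

lemma sq_sub_one_mul_rodrigues (n : ℕ) :
    (Polynomial.X ^ 2 - 1) * rodrigues n = (2 * ((n : Polynomial ℝ) + 1)) * rodrigues (n + 1) := by
  rw [rodrigues, rodrigues, C_rodrigues_coeff n]
  ring

/-- With R_n the Rodrigues power, R'_{n+1} = X R_n, so P'_{n+1} is the (n+1)-st derivative of X R_n,
and Leibniz' rule stops after two terms. -/
lemma derivative_legendreP_succ (n : ℕ) :
    Polynomial.derivative (legendreP (n + 1))
      = Polynomial.derivative (legendreP n) * Polynomial.X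
        + ((n : Polynomial ℝ) + 1) * legendreP n := by
  simp only [legendreP_eq_iterate_derivative]
  rw [← Function.iterate_succ_apply' (f := Polynomial.derivative), Function.iterate_succ_apply,
    derivative_rodrigues_succ, Polynomial.iterate_derivative_mul_X]
  simp [Function.iterate_succ_apply']

lemma derivative_legendreP_add_two (n : ℕ) :
    Polynomial.derivative (legendreP (n + 2))
      = ((2 * n + 3 : ℕ) : ℝ) • legendreP (n + 1) + Polynomial.derivative (legendreP n) := by
  -- Differentiating X R_{n+1} gives R_{n+1} + X² R_n; writing X² = (X² - 1) + 1 turns the last term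
  -- into 2(n+1) R_{n+1} + R_n.
  have key : Polynomial.derivative (Polynomial.derivative (rodrigues (n + 2)))
      = ((2 * n + 3 : ℕ) : ℝ) • rodrigues (n + 1) + rodrigues n := by
    rw [derivative_rodrigues_succ, Polynomial.derivative_mul, derivative_rodrigues_succ,
      Polynomial.derivative_X, Polynomial.smul_eq_C_mul, map_natCast]
    push_cast
    linear_combination sq_sub_one_mul_rodrigues n
  simp only [legendreP_eq_iterate_derivative]
  rw [← Function.iterate_succ_apply' (f := Polynomial.derivative), Function.iterate_succ_apply,
    Function.iterate_succ_apply, key, iterate_map_add,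
    Polynomial.iterate_derivative_smul, Function.iterate_succ_apply' (n := n) (x := rodrigues n)]

lemma legendreDeriv_succ_succ (n m : ℕ) (t : ℝ) :
    legendreDeriv (n + 1) (m + 1) t
      = t * legendreDeriv n (m + 1) t + ((n : ℝ) + m + 1) * legendreDeriv n m t := by
  have hc : ((n : Polynomial ℝ) + 1) = Polynomial.C ((n : ℝ) + 1) := by simp
  simp only [legendreDeriv]
  rw [Function.iterate_succ_apply, derivative_legendreP_succ, iterate_map_add,
    hc, Polynomial.iterate_derivative_C_mul, Polynomial.iterate_derivative_mul_X,
    ← Function.iterate_succ_apply (f := Polynomial.derivative)]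
  rcases m with _ | m
  · simp; ring
  · rw [Nat.add_sub_cancel, ← Function.iterate_succ_apply (f := Polynomial.derivative)]
    simp; ring

lemma legendreDeriv_add_two_succ (n m : ℕ) (t : ℝ) :
    legendreDeriv (n + 2) (m + 1) t
      = (2 * (n : ℝ) + 3) * legendreDeriv (n + 1) m t + legendreDeriv n (m + 1) t := by
  simp only [legendreDeriv]
  rw [Function.iterate_succ_apply, derivative_legendreP_add_two, iterate_map_add,
    Polynomial.iterate_derivative_smul, ← Function.iterate_succ_apply (f := Polynomial.derivative)]
  simp

lemma mul_legendreDeriv_succ_succ (n m : ℕ) (t : ℝ) :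
    t * legendreDeriv (n + 1) (m + 1) t
      = ((n : ℝ) + 1 - m) * legendreDeriv (n + 1) m t + legendreDeriv n (m + 1) t := by
  have h := legendreDeriv_succ_succ (n + 1) m t
  push_cast at h
  linear_combination legendreDeriv_add_two_succ n m t - h

lemma one_sub_sq_mul_legendreDeriv_succ_succ (n m : ℕ) (t : ℝ) :
    (1 - t ^ 2) * legendreDeriv (n + 1) (m + 1) t
      = ((n : ℝ) + m + 1) * legendreDeriv n m t
        - ((n : ℝ) + 1 - m) * t * legendreDeriv (n + 1) m t := by
  linear_combination legendreDeriv_succ_succ n m t - t * mul_legendreDeriv_succ_succ n m t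

lemma one_sub_sq_mul_legendreDeriv_succ (n m : ℕ) (t : ℝ) :
    (1 - t ^ 2) * legendreDeriv n (m + 1) t
      = ((n : ℝ) + m + 1) * t * legendreDeriv n m t
        - ((n : ℝ) + 1 - m) * legendreDeriv (n + 1) m t := by
  linear_combination t * legendreDeriv_succ_succ n m t - mul_legendreDeriv_succ_succ n m t

lemma legendreDeriv_recurrence (n m : ℕ) (t : ℝ) :
    (2 * (n : ℝ) + 3) * t * legendreDeriv (n + 1) m t
      = ((n : ℝ) + 2 - m) * legendreDeriv (n + 2) m t
        + ((n : ℝ) + 1 + m) * legendreDeriv n m t := by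
  have h := one_sub_sq_mul_legendreDeriv_succ (n + 1) m t
  push_cast at h
  linear_combination one_sub_sq_mul_legendreDeriv_succ_succ n m t - h

/-- This is the coefficient of the order-lowering part z^k when ∂₁ or ∂₂ acts on the harmonic of
order k + 1. -/
lemma legendreDeriv_lower_order (n k : ℕ) (t : ℝ) :
    2 * ((k : ℝ) + 1) * legendreDeriv (n + 1) (k + 1) t
        - (1 - t ^ 2) * legendreDeriv n (k + 2) t
      = ((n : ℝ) + k + 1) * ((n : ℝ) + k + 2) * legendreDeriv n k t := by
  have h := one_sub_sq_mul_legendreDeriv_succ n (k + 1) t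
  push_cast at h
  linear_combination ((n : ℝ) + k + 2) * legendreDeriv_succ_succ n k t - h

lemma one_sub_sq_mul_legendreDeriv_middle (n k : ℕ) (t : ℝ) :
    (2 * (n : ℝ) + 3) * (1 - t ^ 2) * legendreDeriv (n + 1) (k + 1) t
      = ((n : ℝ) + k + 2) * ((n : ℝ) + k + 1) * legendreDeriv n k t
        - ((n : ℝ) + 1 - k) * ((n : ℝ) + 2 - k) * legendreDeriv (n + 2) k t := by
  linear_combination (2 * (n : ℝ) + 3) * one_sub_sq_mul_legendreDeriv_succ_succ n k t
    - ((n : ℝ) + 1 - k) * legendreDeriv_recurrence n k t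

lemma legendreDeriv_zero_succ (m : ℕ) (t : ℝ) : legendreDeriv 0 (m + 1) t = 0 := by
  have : legendreP 0 = 1 := by simp [legendreP]
  rw [legendreDeriv, this, Polynomial.iterate_derivative_one (Nat.succ_pos m)]
  simp

lemma hasDerivAt_legendreDeriv (n m : ℕ) (t : ℝ) :
    HasDerivAt (legendreDeriv n m) (legendreDeriv n (m + 1) t) t := by
  unfold legendreDeriv
  rw [Function.iterate_succ_apply']
  exact Polynomial.hasDerivAt _ _

/-! ### Factorization of the solid harmonics -/

/-- The zonal factor `ρ^(n-m) P_n^{(m)}(x₀ / ρ)` of a solid harmonic. -/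
noncomputable def zonal (n m : ℕ) (x : E3) : ℝ :=
  ‖x‖ ^ n / ‖x‖ ^ m * legendreDeriv n m (x 0 / ‖x‖)

/-- The real (upper sign) or imaginary (lower sign) part of `(a + b i)ᵐ`. -/
noncomputable def planar : Sgn → ℕ → ℝ → ℝ → ℝ
  | .plus, m, a, b => ((⟨a, b⟩ : ℂ) ^ m).re
  | .minus, m, a, b => ((⟨a, b⟩ : ℂ) ^ m).im

lemma planar_succ (s : Sgn) (m : ℕ) (a b : ℝ) :
    planar s (m + 1) a b = a * planar s m a b - s.val * b * planar s.flip m a b := by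
  cases s <;> simp only [planar, Sgn.flip, Sgn.val, pow_succ, Complex.mul_re, Complex.mul_im] <;>
    ring

lemma planar_plus_zero (a b : ℝ) : planar .plus 0 a b = 1 := by simp [planar]

lemma planar_minus_zero (a b : ℝ) : planar .minus 0 a b = 0 := by simp [planar]

lemma sgn_val_mul_self (s : Sgn) : s.val * s.val = 1 := by cases s <;> simp [Sgn.val]

lemma sgn_flip_flip (s : Sgn) : s.flip.flip = s := by cases s <;> rfl

lemma sgn_val_flip (s : Sgn) : s.flip.val = -s.val := by cases s <;> simp [Sgn.val, Sgn.flip]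

lemma norm_sq_E3 (x : E3) : ‖x‖ ^ 2 = x 0 ^ 2 + x 1 ^ 2 + x 2 ^ 2 := by
  rw [EuclideanSpace.real_norm_sq_eq, Fin.sum_univ_three]

lemma planar_eq_norm_mul_trig (s : Sgn) (m : ℕ) (z : ℂ) :
    planar s m z.re z.im = ‖z‖ ^ m * trig s (m * z.arg) := by
  have h : z ^ m = ((‖z‖ ^ m : ℝ) : ℂ)
      * ((Real.cos (m * z.arg) : ℝ) + (Real.sin (m * z.arg) : ℝ) * Complex.I) := by
    conv_lhs => rw [← Complex.norm_mul_cos_add_sin_mul_I z]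
    rw [mul_pow, Complex.cos_add_sin_mul_I_pow]
    push_cast
    rfl
  cases s
  · simp only [planar, trig, Complex.eta, h, Complex.re_ofReal_mul, Complex.add_re,
      Complex.ofReal_re, Complex.I_re, mul_zero, add_zero]
  · simp only [planar, trig, Complex.eta, h, Complex.im_ofReal_mul, Complex.add_im,
      Complex.ofReal_im, Complex.I_im, mul_one, zero_add]

lemma norm_mul_sqrt_one_sub_sq {x : E3} (hx : x ≠ 0) :
    ‖x‖ * Real.sqrt (1 - (x 0 / ‖x‖) ^ 2) = ‖(⟨x 1, x 2⟩ : ℂ)‖ := by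
  have hr : 0 < ‖x‖ := norm_pos_iff.mpr hx
  have h : 1 - (x 0 / ‖x‖) ^ 2 = (x 1 * x 1 + x 2 * x 2) / ‖x‖ ^ 2 := by
    field_simp
    rw [norm_sq_E3]
    ring
  rw [h, Real.sqrt_div (add_nonneg (mul_self_nonneg _) (mul_self_nonneg _)), Real.sqrt_sq hr.le, mul_div_cancel₀ _ hr.ne',
    Complex.norm_def, Complex.normSq_mk]

/-- De Moivre's formula removes the azimuth, so neither its branch cut nor the x₀-axis matters for
differentiation. -/
lemma solidU_eq {x : E3} (hx : x ≠ 0) (s : Sgn) (n m : ℕ) :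
    solidU s n m x = (-1) ^ m * zonal n m x * planar s m (x 1) (x 2) := by
  have hr : ‖x‖ ≠ 0 := norm_ne_zero_iff.mpr hx
  have hp := planar_eq_norm_mul_trig s m ⟨x 1, x 2⟩
  rw [← norm_mul_sqrt_one_sub_sq hx, mul_pow] at hp
  simp only at hp
  rw [hp, solidU, assocLegendre, zonal, legendreDeriv, azimuth]
  field_simp

lemma solidU_zero_succ (s : Sgn) (m : ℕ) (x : E3) : solidU s 0 (m + 1) x = 0 := by
  have h := legendreDeriv_zero_succ m (x 0 / ‖x‖)
  rw [legendreDeriv] at h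
  rw [solidU, assocLegendre, h]
  ring

/-- The division-free form of the convention, valid also for n = 0. -/
lemma solidUPred_zero (s : Sgn) (n : ℕ) (x : E3) :
    (n : ℝ) * ((n : ℝ) + 1) * solidUPred s n 0 x = -s.val * solidU s n 1 x := by
  rcases n with _ | n
  · simp [solidU_zero_succ]
  · have : ((n + 1 : ℕ) : ℝ) ≠ 0 := by positivity
    have : ((n + 1 : ℕ) : ℝ) + 1 ≠ 0 := by positivity
    rw [solidUPred]
    field_simp

/-! ### Multiplication by coordinates -/

lemma zonal_recurrence {x : E3} (hx : x ≠ 0) (n m : ℕ) :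
    (2 * (n : ℝ) + 3) * x 0 * zonal (n + 1) m x
      = ((n : ℝ) + 2 - m) * zonal (n + 2) m x
        + ((n : ℝ) + 1 + m) * ‖x‖ ^ 2 * zonal n m x := by
  have hr : ‖x‖ ≠ 0 := norm_ne_zero_iff.mpr hx
  have h := legendreDeriv_recurrence n m (x 0 / ‖x‖)
  have h0 : x 0 = ‖x‖ * (x 0 / ‖x‖) := by field_simp
  simp only [zonal]
  generalize x 0 / ‖x‖ = t at *
  rw [h0]
  linear_combination ‖x‖ ^ (n + 2) / ‖x‖ ^ m * h

lemma zonal_add_two_succ {x : E3} (hx : x ≠ 0) (n m : ℕ) :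
    zonal (n + 2) (m + 1) x
      = (2 * (n : ℝ) + 3) * zonal (n + 1) m x + ‖x‖ ^ 2 * zonal n (m + 1) x := by
  have hr : ‖x‖ ≠ 0 := norm_ne_zero_iff.mpr hx
  have h := legendreDeriv_add_two_succ n m (x 0 / ‖x‖)
  simp only [zonal]
  rw [h]
  field_simp
  ring

lemma sq_add_sq_eq {x : E3} (hx : x ≠ 0) :
    x 1 ^ 2 + x 2 ^ 2 = ‖x‖ ^ 2 * (1 - (x 0 / ‖x‖) ^ 2) := by
  have hr : ‖x‖ ≠ 0 := norm_ne_zero_iff.mpr hx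
  field_simp
  rw [norm_sq_E3]
  ring

lemma sq_add_sq_mul_zonal {x : E3} (hx : x ≠ 0) (n k : ℕ) :
    (2 * (n : ℝ) + 3) * (x 1 ^ 2 + x 2 ^ 2) * zonal (n + 1) (k + 1) x
      = ((n : ℝ) + k + 2) * ((n : ℝ) + k + 1) * ‖x‖ ^ 2 * zonal n k x
        - ((n : ℝ) + 1 - k) * ((n : ℝ) + 2 - k) * zonal (n + 2) k x := by
  have hr : ‖x‖ ≠ 0 := norm_ne_zero_iff.mpr hx
  have h := one_sub_sq_mul_legendreDeriv_middle n k (x 0 / ‖x‖)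
  rw [sq_add_sq_eq hx]
  simp only [zonal]
  generalize x 0 / ‖x‖ = t at *
  have e : ‖x‖ ^ 2 * (‖x‖ ^ (n + 1) / ‖x‖ ^ (k + 1)) = ‖x‖ ^ (n + 2) / ‖x‖ ^ k := by
    field_simp
    ring
  linear_combination ‖x‖ ^ (n + 2) / ‖x‖ ^ k * h
    + (2 * (n : ℝ) + 3) * (1 - t ^ 2) * legendreDeriv (n + 1) (k + 1) t * e

lemma zonal_lower_order {x : E3} (hx : x ≠ 0) (n k : ℕ) :
    2 * ((k : ℝ) + 1) * zonal (n + 1) (k + 1) x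
        - (x 1 ^ 2 + x 2 ^ 2) * zonal n (k + 2) x
      = ((n : ℝ) + k + 1) * ((n : ℝ) + k + 2) * zonal n k x := by
  have hr : ‖x‖ ≠ 0 := norm_ne_zero_iff.mpr hx
  have h := legendreDeriv_lower_order n k (x 0 / ‖x‖)
  rw [sq_add_sq_eq hx]
  simp only [zonal]
  generalize x 0 / ‖x‖ = t at *
  have e : ‖x‖ ^ 2 * (‖x‖ ^ n / ‖x‖ ^ (k + 2)) = ‖x‖ ^ n / ‖x‖ ^ k := by
    field_simp
    ring
  have e' : ‖x‖ ^ (n + 1) / ‖x‖ ^ (k + 1) = ‖x‖ ^ n / ‖x‖ ^ k := by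
    field_simp
    ring
  linear_combination ‖x‖ ^ n / ‖x‖ ^ k * h
    - (1 - t ^ 2) * legendreDeriv n (k + 2) t * e
    + 2 * ((k : ℝ) + 1) * legendreDeriv (n + 1) (k + 1) t * e'

lemma coord_zero_mul_solidU {x : E3} (hx : x ≠ 0) (s : Sgn) (n m : ℕ) :
    (2 * (n : ℝ) + 3) * x 0 * solidU s (n + 1) m x
      = ((n : ℝ) + 2 - m) * solidU s (n + 2) m x
        + ((n : ℝ) + 1 + m) * ‖x‖ ^ 2 * solidU s n m x := by
  simp only [solidU_eq hx]
  linear_combination (-1) ^ m * planar s m (x 1) (x 2) * zonal_recurrence hx n m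

lemma coord_zero_mul_solidUPred {x : E3} (hx : x ≠ 0) (s : Sgn) (n m : ℕ) :
    (2 * (n : ℝ) + 3) * x 0 * solidUPred s (n + 1) m x
      = ((n : ℝ) + 3 - m) * solidUPred s (n + 2) m x
        + ((n : ℝ) + m) * ‖x‖ ^ 2 * solidUPred s n m x := by
  rcases m with _ | m
  · have h := coord_zero_mul_solidU hx s n 1
    have h0 := solidUPred_zero s n x
    have h1 := solidUPred_zero s (n + 1) x
    have h2 := solidUPred_zero s (n + 2) x
    -- This factor clears the denominators of U_{n+1,-1} and U_{n+2,-1}; the one of U_{n,-1} is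
    -- cleared with the help of its own coefficient n.
    have hn : ((n : ℝ) + 1) * ((n : ℝ) + 2) ≠ 0 := by positivity
    push_cast at h h1 h2 ⊢
    apply mul_left_cancel₀ hn
    linear_combination (2 * (n : ℝ) + 3) * x 0 * h1 - s.val * h - ((n : ℝ) + 1) * h2
      - ((n : ℝ) + 2) * ‖x‖ ^ 2 * h0
  · have h := coord_zero_mul_solidU hx s n m
    simp only [solidUPred]
    push_cast
    linear_combination h

/-- Since 2 Re(z) z^m = z^(m+1) + |z|² z^(m-1) for m ≥ 1, the zonal factor is rewritten by
`zonal_add_two_succ` in the first term and by `sq_add_sq_mul_zonal` in the second. -/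
lemma coord_one_mul_solidU {x : E3} (hx : x ≠ 0) (s : Sgn) (n m : ℕ) :
    2 * (2 * (n : ℝ) + 3) * x 1 * solidU s (n + 1) m x
      = -(solidU s (n + 2) (m + 1) x - ‖x‖ ^ 2 * solidU s n (m + 1) x)
        - ((n : ℝ) + m + 1) * ((n : ℝ) + m) * ‖x‖ ^ 2 * solidUPred s n m x
        + ((n : ℝ) + 2 - m) * ((n : ℝ) + 3 - m) * solidUPred s (n + 2) m x := by
  have hb := zonal_add_two_succ hx n m
  rcases m with _ | m
  · have h0 := solidUPred_zero s n x
    have h2 := solidUPred_zero s (n + 2) x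
    push_cast at h0 h2 ⊢
    -- For m = 0 the terms of order -1 double those of order 1 for the upper sign and cancel them
    -- for the lower, where U⁻_{n+1,0} = 0.
    have e : -(solidU s (n + 2) (0 + 1) x - ‖x‖ ^ 2 * solidU s n (0 + 1) x)
        - ((n : ℝ) + 0 + 1) * ((n : ℝ) + 0) * ‖x‖ ^ 2 * solidUPred s n 0 x
        + ((n : ℝ) + 2 - 0) * ((n : ℝ) + 3 - 0) * solidUPred s (n + 2) 0 x
        = -(1 + s.val) * (solidU s (n + 2) (0 + 1) x - ‖x‖ ^ 2 * solidU s n (0 + 1) x) := by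
      linear_combination h2 - ‖x‖ ^ 2 * h0
    rw [e]
    simp only [solidU_eq hx, planar_succ]
    rw [hb]
    cases s <;> simp only [Sgn.flip, Sgn.val, planar_plus_zero, planar_minus_zero] <;> ring
  · have h6 := sq_add_sq_mul_zonal hx n m
    simp only [solidUPred, solidU_eq hx, planar_succ, sgn_flip_flip, sgn_val_flip]
    rw [hb]
    push_cast
    linear_combination (-1) ^ (m + 1) * planar s m (x 1) (x 2) * h6
      + (2 * (n : ℝ) + 3) * (-1) ^ (m + 1) * zonal (n + 1) (m + 1) x * x 2 ^ 2
        * planar s m (x 1) (x 2) * sgn_val_mul_self s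

lemma coord_two_mul_solidU {x : E3} (hx : x ≠ 0) (s : Sgn) (n m : ℕ) :
    2 * (2 * (n : ℝ) + 3) * x 2 * solidU s (n + 1) m x
      = s.val * (-(solidU s.flip (n + 2) (m + 1) x - ‖x‖ ^ 2 * solidU s.flip n (m + 1) x)
        + ((n : ℝ) + m + 1) * ((n : ℝ) + m) * ‖x‖ ^ 2 * solidUPred s.flip n m x
        - ((n : ℝ) + 2 - m) * ((n : ℝ) + 3 - m) * solidUPred s.flip (n + 2) m x) := by
  have hb := zonal_add_two_succ hx n m
  rcases m with _ | m
  · have h0 := solidUPred_zero s.flip n x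
    have h2 := solidUPred_zero s.flip (n + 2) x
    rw [sgn_val_flip] at h0 h2
    push_cast at h0 h2 ⊢
    have e : -(solidU s.flip (n + 2) (0 + 1) x - ‖x‖ ^ 2 * solidU s.flip n (0 + 1) x)
        + ((n : ℝ) + 0 + 1) * ((n : ℝ) + 0) * ‖x‖ ^ 2 * solidUPred s.flip n 0 x
        - ((n : ℝ) + 2 - 0) * ((n : ℝ) + 3 - 0) * solidUPred s.flip (n + 2) 0 x
        = -(1 + s.val)
          * (solidU s.flip (n + 2) (0 + 1) x - ‖x‖ ^ 2 * solidU s.flip n (0 + 1) x) := by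
      linear_combination ‖x‖ ^ 2 * h0 - h2
    rw [e]
    simp only [solidU_eq hx, planar_succ]
    rw [hb]
    cases s <;> simp only [Sgn.flip, Sgn.val, planar_plus_zero, planar_minus_zero] <;> ring
  · have h6 := sq_add_sq_mul_zonal hx n m
    simp only [solidUPred, solidU_eq hx, planar_succ, sgn_flip_flip, sgn_val_flip]
    rw [hb]
    push_cast
    cases s <;> simp only [Sgn.flip, Sgn.val]
    · linear_combination -(-1) ^ (m + 1) * planar .minus m (x 1) (x 2) * h6
    · linear_combination (-1) ^ (m + 1) * planar .plus m (x 1) (x 2) * h6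

/-! ### Partial derivatives of the solid harmonics -/

lemma hasDerivAt_line_apply (x v : E3) (i : Fin 3) :
    HasDerivAt (fun t : ℝ => (x + t • v) i) (v i) 0 := by
  simpa using ((hasDerivAt_id (0 : ℝ)).mul_const (v i)).const_add (x i)

lemma hasLineDerivAt_norm {x : E3} (hx : x ≠ 0) (v : E3) :
    HasLineDerivAt ℝ (fun y : E3 => ‖y‖)
      ((x 0 * v 0 + x 1 * v 1 + x 2 * v 2) / ‖x‖) x v := by
  have hr : ‖x‖ ≠ 0 := norm_ne_zero_iff.mpr hx
  have h (i : Fin 3) := (hasDerivAt_line_apply x v i).pow 2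
  have hs := (((h 0).add (h 1)).add (h 2)).sqrt (by
    simp only [Pi.add_apply, Pi.pow_apply, ← norm_sq_E3, zero_smul, add_zero]
    positivity)
  refine (hs.congr_deriv ?_).congr_of_eventuallyEq (.of_forall fun t => ?_)
  · simp only [Pi.add_apply, Pi.pow_apply, ← norm_sq_E3, zero_smul, add_zero,
      Real.sqrt_sq (norm_nonneg x)]
    field_simp
    ring
  · simp only [Pi.add_apply, Pi.pow_apply, ← norm_sq_E3, Real.sqrt_sq (norm_nonneg _)]

lemma hasLineDerivAt_zonal {x : E3} (hx : x ≠ 0) (n m : ℕ) (v : E3) :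
    HasLineDerivAt ℝ (zonal (n + 1) m)
      (v 0 * (((n : ℝ) + m + 1) * zonal n m x)
        - (x 1 * v 1 + x 2 * v 2) * zonal n (m + 1) x) x v := by
  have hr : ‖x‖ ≠ 0 := norm_ne_zero_iff.mpr hx
  have hN : HasDerivAt (fun t : ℝ => ‖x + t • v‖) _ 0 := hasLineDerivAt_norm hx v
  have h0 := hasDerivAt_line_apply x v 0
  have hr0 : ‖x + (0 : ℝ) • v‖ ≠ 0 := by simpa using hx
  have ht := h0.div hN hr0
  have hP := (hasDerivAt_legendreDeriv (n + 1) m ((x + (0 : ℝ) • v) 0 / ‖x + (0 : ℝ) • v‖)).comp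
    (0 : ℝ) ht
  have hQ := ((hN.pow (n + 1)).div (hN.pow m) (pow_ne_zero m hr0)).mul hP
  refine HasDerivAt.congr_deriv hQ ?_
  -- `h1` yields the x₀-derivative and `h2` the derivatives in x₁ and x₂.
  have h1 := one_sub_sq_mul_legendreDeriv_succ_succ n m (x 0 / ‖x‖)
  have h2 := mul_legendreDeriv_succ_succ n m (x 0 / ‖x‖)
  have e0 : x 0 = ‖x‖ * (x 0 / ‖x‖) := by field_simp
  simp only [Pi.div_apply, Pi.pow_apply, Function.comp_apply, zero_smul, add_zero, zonal]
  generalize x 0 / ‖x‖ = t at *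
  rw [e0]
  have hm : (m : ℝ) * ‖x‖ ^ (m - 1) = m * ‖x‖ ^ m / ‖x‖ := by
    rcases m with _ | m
    · simp
    · rw [Nat.add_sub_cancel]
      field_simp
      ring
  rw [hm, Nat.add_sub_cancel]
  push_cast
  linear_combination (norm := (field_simp; ring)) ‖x‖ ^ n / ‖x‖ ^ m * v 0 * h1
    - (x 1 * v 1 + x 2 * v 2) * ‖x‖ ^ n / ‖x‖ ^ (m + 1) * h2

lemma hasLineDerivAt_planar (s : Sgn) (m : ℕ) (x v : E3) :
    HasLineDerivAt ℝ (fun y : E3 => planar s m (y 1) (y 2))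
      (m * (v 1 * planar s (m - 1) (x 1) (x 2)
        - s.val * v 2 * planar s.flip (m - 1) (x 1) (x 2))) x v := by
  have hz : HasDerivAt (fun t : ℝ => (⟨(x + t • v) 1, (x + t • v) 2⟩ : ℂ)) ⟨v 1, v 2⟩ 0 := by
    have h := (hasDerivAt_line_apply x v 1).ofReal_comp.add
      ((hasDerivAt_line_apply x v 2).ofReal_comp.mul_const Complex.I)
    refine (h.congr_deriv (Complex.mk_eq_add_mul_I _ _).symm).congr_of_eventuallyEq
      (.of_forall fun t => ?_)
    exact Complex.mk_eq_add_mul_I _ _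
  have hp := hz.pow m
  cases s
  · refine HasDerivAt.congr_deriv (Complex.reCLM.hasFDerivAt.comp_hasDerivAt (0 : ℝ) hp) ?_
    simp only [zero_smul, add_zero, Complex.reCLM_apply, planar, Sgn.flip, Sgn.val, mul_assoc]
    simp
    left
    ring
  · refine HasDerivAt.congr_deriv (Complex.imCLM.hasFDerivAt.comp_hasDerivAt (0 : ℝ) hp) ?_
    simp only [zero_smul, add_zero, Complex.imCLM_apply, planar, Sgn.flip, Sgn.val, mul_assoc]
    simp
    left
    ring

/-- In the product rule for ∂₁ and ∂₂, the zonal factor contributes x₁z^m or x₂z^m, which splits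
into z^(m+1) and |z|² z^(m-1); the latter joins the derivative of z^m through `zonal_lower_order`.
-/
lemma hasLineDerivAt_solidU {x : E3} (hx : x ≠ 0) (s : Sgn) (n m : ℕ) (v : E3) :
    HasLineDerivAt ℝ (solidU s (n + 1) m)
      (v 0 * (((n : ℝ) + m + 1) * solidU s n m x)
        - v 1 * (1 / 2 * (((n : ℝ) + m) * ((n : ℝ) + m + 1) * solidUPred s n m x
          - solidU s n (m + 1) x))
        + v 2 * (s.val * (1 / 2 * (((n : ℝ) + m) * ((n : ℝ) + m + 1) * solidUPred s.flip n m x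
          + solidU s.flip n (m + 1) x)))) x v := by
  have hz : HasDerivAt (fun t : ℝ => zonal (n + 1) m (x + t • v)) _ 0 :=
    hasLineDerivAt_zonal hx n m v
  have hp : HasDerivAt (fun t : ℝ => planar s m ((x + t • v) 1) ((x + t • v) 2)) _ 0 :=
    hasLineDerivAt_planar s m x v
  have hne : ∀ᶠ t : ℝ in nhds 0, x + t • v ≠ 0 := by
    have hc : ContinuousAt (fun t : ℝ => x + t • v) 0 := by fun_prop
    exact hc.eventually_ne (by simpa using hx)
  have h := (hz.const_mul ((-1) ^ m)).mul hp
  refine (h.congr_deriv ?_).congr_of_eventuallyEq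
    (hne.mono fun t ht => solidU_eq ht s (n + 1) m)
  simp only [zero_smul, add_zero]
  rcases m with _ | m
  · have h0 := solidUPred_zero s n x
    have h1 := solidUPred_zero s.flip n x
    have e1 : ((n : ℝ) + (0 : ℕ)) * ((n : ℝ) + (0 : ℕ) + 1) * solidUPred s n 0 x
        = -s.val * solidU s n 1 x := by simpa using h0
    have e2 : ((n : ℝ) + (0 : ℕ)) * ((n : ℝ) + (0 : ℕ) + 1) * solidUPred s.flip n 0 x
        = s.val * solidU s.flip n 1 x := by simpa [sgn_val_flip] using h1
    rw [e1, e2]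
    simp only [solidU_eq hx, planar_succ]
    cases s
    · simp [Sgn.flip, Sgn.val, planar_plus_zero, planar_minus_zero]
      ring
    · simp [Sgn.flip, Sgn.val, planar_minus_zero]
  · have h3 := zonal_lower_order hx n m
    simp only [solidUPred, solidU_eq hx, planar_succ, sgn_flip_flip, sgn_val_flip,
      Nat.add_sub_cancel]
    push_cast
    cases s <;> simp only [Sgn.flip, Sgn.val]
    · linear_combination (-1) ^ (m + 1) * (1 / 2) * (v 1 * planar .plus m (x 1) (x 2)
        - v 2 * planar .minus m (x 1) (x 2)) * h3
    · linear_combination (-1) ^ (m + 1) * (1 / 2) * (v 1 * planar .minus m (x 1) (x 2)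
        + v 2 * planar .plus m (x 1) (x 2)) * h3

/-- The angular factors are bounded because x₀/|x| stays in [-1, 1]; for degree at least 2 the bound
forces a zero derivative at the origin. -/
lemma exists_abs_solidU_le (s : Sgn) (n m : ℕ) :
    ∃ c : ℝ, ∀ x : E3, |solidU s n m x| ≤ c * ‖x‖ ^ n := by
  have hc : Continuous (assocLegendre n m) := by
    unfold assocLegendre
    fun_prop
  obtain ⟨c, hc⟩ := (isCompact_Icc (a := (-1 : ℝ)) (b := 1)).exists_bound_of_continuousOn
    hc.continuousOn
  refine ⟨c, fun x => ?_⟩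
  have ht : x 0 / ‖x‖ ∈ Set.Icc (-1 : ℝ) 1 := by
    rw [Set.mem_Icc, ← abs_le, abs_div, abs_norm]
    exact div_le_one_of_le₀ (PiLp.norm_apply_le x 0) (norm_nonneg x)
  have htrig (a : ℝ) : |trig s a| ≤ 1 := by
    cases s
    · exact Real.abs_cos_le_one a
    · exact Real.abs_sin_le_one a
  have h := hc _ ht
  rw [Real.norm_eq_abs] at h
  rw [solidU, abs_mul, abs_mul, abs_pow, abs_norm, mul_comm c]
  have hpos : 0 ≤ ‖x‖ ^ n := by positivity
  calc ‖x‖ ^ n * |assocLegendre n m (x 0 / ‖x‖)| * |trig s (m * azimuth x)|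
      ≤ ‖x‖ ^ n * |assocLegendre n m (x 0 / ‖x‖)| * 1 := by gcongr; exact htrig _
    _ ≤ ‖x‖ ^ n * c := by rw [mul_one]; gcongr

lemma hasLineDerivAt_solidU_zero (s : Sgn) (n m : ℕ) (v : E3) :
    HasLineDerivAt ℝ (solidU s (n + 2) m) 0 0 v := by
  obtain ⟨c, hc⟩ := exists_abs_solidU_le s (n + 2) m
  have hO : (solidU s (n + 2) m) =O[nhds (0 : E3)] fun x => ‖x - 0‖ ^ (n + 2) :=
    Asymptotics.IsBigO.of_bound c (.of_forall fun x => by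
      simpa [sub_zero] using hc x)
  have h := (hO.hasFDerivAt (𝕜 := ℝ) (by omega)).hasLineDerivAt v
  simpa using h

lemma solidU_succ_zero (s : Sgn) (n m : ℕ) : solidU s (n + 1) m 0 = 0 := by
  simp [solidU]

lemma solidUPred_succ_zero (s : Sgn) (n m : ℕ) : solidUPred s (n + 1) m 0 = 0 := by
  cases m <;> simp [solidUPred, solidU_succ_zero]

lemma hasLineDerivAt_solidU_of_pos (s : Sgn) (n m : ℕ) (x v : E3) (h : x ≠ 0 ∨ 1 ≤ n) :
    HasLineDerivAt ℝ (solidU s (n + 1) m)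
      (v 0 * (((n : ℝ) + m + 1) * solidU s n m x)
        - v 1 * (1 / 2 * (((n : ℝ) + m) * ((n : ℝ) + m + 1) * solidUPred s n m x
          - solidU s n (m + 1) x))
        + v 2 * (s.val * (1 / 2 * (((n : ℝ) + m) * ((n : ℝ) + m + 1) * solidUPred s.flip n m x
          + solidU s.flip n (m + 1) x)))) x v := by
  rcases eq_or_ne x 0 with rfl | hx
  · obtain ⟨k, rfl⟩ := Nat.exists_eq_add_of_le' (h.resolve_left (by simp))
    simpa [solidU_succ_zero, solidUPred_succ_zero] using hasLineDerivAt_solidU_zero s k m v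
  · exact hasLineDerivAt_solidU hx s n m v

/-! ### Quaternionic differential operators and reduced quaternion arithmetic. -/

lemma partialD_eq_smul {f : E3 → ℝ} {f' : ℝ} {i : Fin 3} {x : E3}
    (h : HasLineDerivAt ℝ f f' x (EuclideanSpace.single i 1)) (q : Quaternion ℝ) :
    partialD i (fun y => f y • q) x = f' • q :=
  HasLineDerivAt.lineDeriv (HasDerivAt.smul_const h q)

lemma partialD_smul {f : E3 → ℝ} {x : E3} {a b c : ℝ}
    (h : ∀ v : E3, HasLineDerivAt ℝ f (v 0 * a - v 1 * b + v 2 * c) x v) (q : Quaternion ℝ) :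
    partialD 0 (fun y => f y • q) x = a • q ∧ partialD 1 (fun y => f y • q) x = -b • q ∧
      partialD 2 (fun y => f y • q) x = c • q := by
  refine ⟨?_, ?_, ?_⟩
  · simpa using partialD_eq_smul (h (EuclideanSpace.single 0 1)) q
  · simpa using partialD_eq_smul (h (EuclideanSpace.single 1 1)) q
  · simpa using partialD_eq_smul (h (EuclideanSpace.single 2 1)) q

lemma reduced_re (a b c : ℝ) : (reduced a b c).re = a := rfl

lemma reduced_imI (a b c : ℝ) : (reduced a b c).imI = b := rfl

lemma reduced_imJ (a b c : ℝ) : (reduced a b c).imJ = c := rfl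

lemma reduced_imK (a b c : ℝ) : (reduced a b c).imK = 0 := rfl

lemma e₁_eq_reduced : e₁ = reduced 0 1 0 := rfl

lemma e₂_eq_reduced : e₂ = reduced 0 0 1 := rfl

lemma one_eq_reduced : (1 : Quaternion ℝ) = reduced 1 0 0 := rfl

lemma dee_coe {f : E3 → ℝ} {x : E3} {a b c : ℝ}
    (h : ∀ v : E3, HasLineDerivAt ℝ f (v 0 * a - v 1 * b + v 2 * c) x v) :
    dee (fun y => ((f y : ℝ) : Quaternion ℝ)) x = reduced a b (-c) := by
  obtain ⟨h0, h1, h2⟩ := partialD_smul h 1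
  have e : (fun y => ((f y : ℝ) : Quaternion ℝ)) = fun y => f y • (1 : Quaternion ℝ) := by
    funext y
    rw [← Quaternion.coe_mul_eq_smul, mul_one]
  rw [dee, e, h0, h1, h2, one_eq_reduced]
  ext <;> simp [e₁_eq_reduced, e₂_eq_reduced, reduced_re, reduced_imI, reduced_imJ,
    reduced_imK]

lemma deeBar_mul_coe {f : E3 → ℝ} {x : E3} {a b c : ℝ}
    (h : ∀ v : E3, HasLineDerivAt ℝ f (v 0 * a - v 1 * b + v 2 * c) x v) (q : Quaternion ℝ) :
    deeBar (fun y => q * ((f y : ℝ) : Quaternion ℝ)) x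
      = a • q - b • (e₁ * q) + c • (e₂ * q) := by
  obtain ⟨h0, h1, h2⟩ := partialD_smul h q
  have e : (fun y => q * ((f y : ℝ) : Quaternion ℝ)) = fun y => f y • q := by
    funext y
    rw [Quaternion.mul_coe_eq_smul]
  rw [deeBar, e, h0, h1, h2, mul_smul_comm, mul_smul_comm, neg_smul, sub_eq_add_neg]

lemma deeBar_coe {f : E3 → ℝ} {x : E3} {a b c : ℝ}
    (h : ∀ v : E3, HasLineDerivAt ℝ f (v 0 * a - v 1 * b + v 2 * c) x v) :
    deeBar (fun y => ((f y : ℝ) : Quaternion ℝ)) x = reduced a (-b) c := by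
  have e := deeBar_mul_coe h 1
  simp only [one_mul, mul_one] at e
  rw [e, one_eq_reduced]
  ext <;> simp [e₁_eq_reduced, e₂_eq_reduced, reduced_re, reduced_imI, reduced_imJ,
    reduced_imK]

lemma reduced_congr {a b c a' b' c' : ℝ} (ha : a = a') (hb : b = b') (hc : c = c') :
    reduced a b c = reduced a' b' c' := by
  rw [ha, hb, hc]

/-- Symmetrizing cancels the e₁e₂ component, so the result is again reduced. -/
lemma star_toQuat_mul_add_mul_star_toQuat (x : E3) (a b c : ℝ) :
    star (toQuat x) * reduced a b c + reduced a b c * star (toQuat x)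
      = reduced (2 * (x 0 * a + x 1 * b + x 2 * c)) (2 * (x 0 * b - x 1 * a))
          (2 * (x 0 * c - x 2 * a)) := by
  ext <;> simp [toQuat, reduced_re, reduced_imI, reduced_imJ, reduced_imK] <;> ring

lemma smul_reduced (r a b c : ℝ) : r • reduced a b c = reduced (r * a) (r * b) (r * c) := by
  ext <;> simp [reduced_re, reduced_imI, reduced_imJ, reduced_imK]

lemma reduced_add (a b c a' b' c' : ℝ) :
    reduced a b c + reduced a' b' c' = reduced (a + a') (b + b') (c + c') := by
  ext <;> simp [reduced_re, reduced_imI, reduced_imJ, reduced_imK]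

lemma reduced_sub_coe (a b c r : ℝ) :
    reduced a b c - ((r : ℝ) : Quaternion ℝ) = reduced (a - r) b c := by
  ext <;> simp [reduced_re, reduced_imI, reduced_imJ, reduced_imK]

/-! ### The basic polynomials in terms of solid harmonics -/

lemma polyX_eq (s : Sgn) (n m : ℕ) (x : E3) (h : x ≠ 0 ∨ 1 ≤ n) :
    polyX s n m x = reduced
        (((n : ℝ) + m + 1) * solidU s n m x)
        (1 / 2 * (((n : ℝ) + m) * ((n : ℝ) + m + 1) * solidUPred s n m x
          - solidU s n (m + 1) x))
        (-s.val * (1 / 2 * (((n : ℝ) + m) * ((n : ℝ) + m + 1) * solidUPred s.flip n m x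
          + solidU s.flip n (m + 1) x))) := by
  rw [polyX, dee_coe fun v => hasLineDerivAt_solidU_of_pos s n m x v h]
  exact reduced_congr rfl rfl (by ring)

lemma solidU_smul {r : ℝ} (hr : 0 < r) (s : Sgn) (n m : ℕ) (x : E3) :
    solidU s n m (r • x) = r ^ n * solidU s n m x := by
  have h1 : (r • x) 0 / ‖r • x‖ = x 0 / ‖x‖ := by
    rw [norm_smul, Real.norm_of_nonneg hr.le, PiLp.smul_apply, smul_eq_mul,
      mul_div_mul_left _ _ hr.ne']
  have h2 : azimuth (r • x) = azimuth x := by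
    rw [azimuth, azimuth, ← Complex.arg_real_mul ⟨x 1, x 2⟩ hr]
    congr 1
    apply Complex.ext <;> simp
  rw [solidU, solidU, h1, h2, norm_smul, Real.norm_of_nonneg hr.le]
  ring

/-- Euler's relation: the derivative of U along the ray t ↦ (1 + t)x is computed from the gradient
and from homogeneity of degree n + 1. -/
lemma coord_mul_gradient {x : E3} (hx : x ≠ 0) (s : Sgn) (n m : ℕ) :
    x 1 * (1 / 2 * (((n : ℝ) + m) * ((n : ℝ) + m + 1) * solidUPred s n m x
          - solidU s n (m + 1) x))
      - x 2 * (s.val * (1 / 2 * (((n : ℝ) + m) * ((n : ℝ) + m + 1) * solidUPred s.flip n m x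
          + solidU s.flip n (m + 1) x)))
      = x 0 * (((n : ℝ) + m + 1) * solidU s n m x) - ((n : ℝ) + 1) * solidU s (n + 1) m x := by
  have h1 : HasDerivAt (fun t : ℝ => solidU s (n + 1) m (x + t • x)) _ 0 :=
    hasLineDerivAt_solidU hx s n m x
  have h2 : HasDerivAt (fun t : ℝ => (1 + t) ^ (n + 1) * solidU s (n + 1) m x)
      (((n : ℝ) + 1) * solidU s (n + 1) m x) 0 := by
    simpa using ((((hasDerivAt_id (0 : ℝ)).const_add 1).pow (n + 1)).mul_const
      (solidU s (n + 1) m x))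
  have he : (fun t : ℝ => solidU s (n + 1) m (x + t • x))
      =ᶠ[nhds 0] fun t => (1 + t) ^ (n + 1) * solidU s (n + 1) m x := by
    filter_upwards [lt_mem_nhds (show (-1 : ℝ) < 0 by norm_num)] with t ht
    rw [show x + t • x = (1 + t) • x by rw [add_smul, one_smul]]
    exact solidU_smul (by linarith) s (n + 1) m x
  linear_combination -h1.unique (h2.congr_of_eventuallyEq he)

lemma reduced_zero : reduced 0 0 0 = 0 := rfl

lemma toQuat_zero : toQuat 0 = 0 := rfl

theorem mainTheorem6 (n : ℕ) (hn : 2 ≤ n) :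
    -- type 0
    (∀ (s : Sgn) (m : ℕ), (s = Sgn.minus → 1 ≤ m) → m ≤ n + 1 → ∀ x : E3,
      polyX s n m x = reduced
        (((n : ℝ) + m + 1) * solidU s n m x)
        (1 / 2 * (((n : ℝ) + m) * ((n : ℝ) + m + 1) * solidUPred s n m x
          - solidU s n (m + 1) x))
        (-s.val * (1 / 2 * (((n : ℝ) + m) * ((n : ℝ) + m + 1) * solidUPred s.flip n m x
          + solidU s.flip n (m + 1) x)))) ∧
    -- type 1
    (∀ (s : Sgn) (m : ℕ), (s = Sgn.minus → 1 ≤ m) → m ≤ n - 1 → ∀ x : E3,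
      (2 * (n : ℝ) - 1) • polyY s n m x = reduced
        (2 * ((n : ℝ) - 2 * (m : ℝ) ^ 2) * solidU s n m x
          + 2 * (2 * (n : ℝ) + 1) * ((n : ℝ) + m) * ((n : ℝ) - 1 + m)
            * (‖x‖ ^ 2 * solidU s (n - 2) m x))
        (((n : ℝ) + m) * ((n : ℝ) - m + 1) * (2 * (m : ℝ) - 1) * solidUPred s n m x
          + (2 * (n : ℝ) + 1) * ((n : ℝ) + m) * ((n : ℝ) + m - 1) * ((n : ℝ) + m - 2)
            * (‖x‖ ^ 2 * solidUPred s (n - 2) m x)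
          + (2 * (m : ℝ) + 1) * solidU s n (m + 1) x
          - (2 * (n : ℝ) + 1) * ((n : ℝ) + m) * (‖x‖ ^ 2 * solidU s (n - 2) (m + 1) x))
        (-s.val *
          (((n : ℝ) + m) * ((n : ℝ) - m + 1) * (2 * (m : ℝ) - 1) * solidUPred s.flip n m x
          + (2 * (n : ℝ) + 1) * ((n : ℝ) + m) * ((n : ℝ) + m - 1) * ((n : ℝ) + m - 2)
            * (‖x‖ ^ 2 * solidUPred s.flip (n - 2) m x)
          - (2 * (m : ℝ) + 1) * solidU s.flip n (m + 1) x
          + (2 * (n : ℝ) + 1) * ((n : ℝ) + m)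
            * (‖x‖ ^ 2 * solidU s.flip (n - 2) (m + 1) x)))) ∧
    -- type 2, order zero
    (∀ x : E3, polyZ₀ n x = reduced 0 (solidU Sgn.minus n 1 x) (-solidU Sgn.plus n 1 x)) ∧
    -- type 2, positive order
    (∀ (s : Sgn) (m : ℕ), 1 ≤ m → m ≤ n → ∀ x : E3,
      (2 * (n : ℝ) - 1) • polyZ s n m x = reduced
        (-(2 * (m : ℝ) - 1) * (2 * (m : ℝ) + 1) * solidU s n m x
          + (2 * (n : ℝ) + 3) * ((n : ℝ) + m) * ((n : ℝ) + m - 1)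
            * (‖x‖ ^ 2 * solidU s (n - 2) m x))
        (((n : ℝ) + m) * ((n : ℝ) - m + 1) * (2 * (m : ℝ) - 1) * solidUPred s n m x
          + (2 * (n : ℝ) + 3) * ((n : ℝ) + m) * ((n : ℝ) + m - 1) * ((n : ℝ) + m - 2) / 2
            * (‖x‖ ^ 2 * solidUPred s (n - 2) m x)
          + (2 * (m : ℝ) + 1) * solidU s n (m + 1) x
          - (2 * (n : ℝ) + 3) * ((n : ℝ) + m) / 2 * (‖x‖ ^ 2 * solidU s (n - 2) (m + 1) x))
        (-s.val *
          (((n : ℝ) + m) * ((n : ℝ) - m + 1) * (2 * (m : ℝ) - 1) * solidUPred s.flip n m x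
          + (2 * (n : ℝ) + 3) * ((n : ℝ) + m) * ((n : ℝ) + m - 1) * ((n : ℝ) + m - 2) / 2
            * (‖x‖ ^ 2 * solidUPred s.flip (n - 2) m x)
          - (2 * (m : ℝ) + 1) * solidU s.flip n (m + 1) x
          + (2 * (n : ℝ) + 3) * ((n : ℝ) + m) / 2
            * (‖x‖ ^ 2 * solidU s.flip (n - 2) (m + 1) x)))) := by
  -- From here on the degree is n + 2, so the factor 2n - 1 of the statement becomes 2n + 3.
  obtain ⟨n, rfl⟩ := Nat.exists_eq_add_of_le' hn
  have hsub : n + 2 - 1 = n + 1 := rfl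
  refine ⟨fun s m _ _ x => polyX_eq s (n + 2) m x (.inr (by omega)), fun s m _ _ x => ?_,
    fun x => ?_, fun s m _ _ x => ?_⟩
  · rcases eq_or_ne x 0 with rfl | hx
    -- At the origin x̄ and |x|² kill every term, so no value of X there is needed; `polyX_eq` would
    -- not cover degree 0.
    · rw [polyY, toQuat_zero]
      simp [solidU_succ_zero, solidUPred_succ_zero, reduced_zero]
    · have c0 := coord_zero_mul_solidU hx s n m
      have c0p := coord_zero_mul_solidUPred hx s n m
      have c0pf := coord_zero_mul_solidUPred hx s.flip n m
      have c0s := coord_zero_mul_solidU hx s n (m + 1)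
      have c0sf := coord_zero_mul_solidU hx s.flip n (m + 1)
      have c1 := coord_one_mul_solidU hx s n m
      have c2 := coord_two_mul_solidU hx s n m
      have g := coord_mul_gradient hx s (n + 1) m
      rw [polyY, Nat.add_sub_cancel, hsub, polyX_eq s n m x (.inl hx),
        polyX_eq s (n + 1) m x (.inl hx), star_toQuat_mul_add_mul_star_toQuat, smul_reduced,
        reduced_add, smul_reduced]
      push_cast at *
      refine reduced_congr ?_ ?_ ?_
      -- Euler's relation `g` leaves only a multiple of x₀U_{n+1,m}, which `c0` expands.
      · linear_combination 2 * (2 * (n : ℝ) + 3) * g + 4 * ((n : ℝ) + 2 + m) * c0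
      · linear_combination ((n : ℝ) + 1 + m) * ((n : ℝ) + 2 + m) * c0p - c0s
          - ((n : ℝ) + m + 2) * c1
      · linear_combination -s.val * (((n : ℝ) + 1 + m) * ((n : ℝ) + 2 + m) * c0pf + c0sf)
          - ((n : ℝ) + m + 2) * c2
  · have h1 := hasLineDerivAt_solidU_of_pos .plus (n + 2) 1 x (h := .inr (by omega))
    have h2 := hasLineDerivAt_solidU_of_pos .minus (n + 2) 1 x (h := .inr (by omega))
    -- In the scalar part the harmonics of order 2 cancel and only a multiple of U⁻ of order 0
    -- remains.
    have hm : solidU .minus (n + 2) 0 x = 0 := by simp [solidU, trig]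
    rw [polyZ₀, deeBar_coe h1, deeBar_coe h2, deeBar_mul_coe h1, deeBar_mul_coe h2,
      e₁_eq_reduced, e₂_eq_reduced]
    have hn4 : (n : ℝ) + 2 + 2 ≠ 0 := by positivity
    ext <;> simp [reduced_re, reduced_imI, reduced_imJ, reduced_imK, Sgn.flip, Sgn.val,
      solidUPred, hm] <;> field_simp <;> ring
  · rcases eq_or_ne x 0 with rfl | hx
    · rw [polyZ, toQuat_zero]
      simp [solidU_succ_zero, solidUPred_succ_zero, reduced_zero]
    · have c0 := coord_zero_mul_solidU hx s n m
      have c0p := coord_zero_mul_solidUPred hx s n m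
      have c0pf := coord_zero_mul_solidUPred hx s.flip n m
      have c0s := coord_zero_mul_solidU hx s n (m + 1)
      have c0sf := coord_zero_mul_solidU hx s.flip n (m + 1)
      have c1 := coord_one_mul_solidU hx s n m
      have c2 := coord_two_mul_solidU hx s n m
      have g := coord_mul_gradient hx s (n + 1) m
      rw [polyZ, Nat.add_sub_cancel, hsub, polyX_eq s n m x (.inl hx),
        polyX_eq s (n + 1) m x (.inl hx), star_toQuat_mul_add_mul_star_toQuat, smul_reduced,
        reduced_sub_coe, reduced_add, smul_reduced]
      push_cast at *
      refine reduced_congr ?_ ?_ ?_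
      -- The coefficients are those used for Y: the difference Y - Z = U_{n,m} + (n+m)|x|² X_{n-2,m}
      -- needs no recurrence once X is expanded.
      · linear_combination 2 * (2 * (n : ℝ) + 3) * g + 4 * ((n : ℝ) + 2 + m) * c0
      · linear_combination ((n : ℝ) + 1 + m) * ((n : ℝ) + 2 + m) * c0p - c0s
          - ((n : ℝ) + m + 2) * c1
      · linear_combination -s.val * (((n : ℝ) + 1 + m) * ((n : ℝ) + 2 + m) * c0pf + c0sf)
          - ((n : ℝ) + m + 2) * c2
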